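/- **Setting.** A quitting game with player set $I=\{1,\dots,N\}$ is given by vectors $r^S\in[-1,1]^N$, $S\subseteq I$. At every stage $t\in\mathbb N$ each player decides whether to continue or to quit; if $S^*\neq\emptyset$ is the set of players who quit at the first stage at which somebody quits, the payoff vector is $r^{S^*}$, and if nobody ever quits, then $S^*=\emptyset$ and the payoff vector is $r^{\emptyset}$. Write $r^i$ for $r^{\{i\}}$, and assume that $r^i_i=0$ for every $i\in I$. *Sunspot equilibrium.* At the beginning of each stage $t$ the players observe a public signal $s^t$, uniformly distributed on $[0,1]$ and independent of past signals. A strategy of player $i$ is a sequence of measurable functions $\xi_i^t:[0,1]^t\to[0,1]$, where $\xi_i^t(s^1,\dots,s^t)$ is the probability that player $i$ quits at stage $t$ if nobody has quit before; given the signals, the players randomize independently. Let $\gamma(\xi)=\mathbb E_\xi[r^{S^*}]\in\mathbb R^N$. A strategy profile $\xi$ is a *sunspot $\varepsilon$-equilibrium* if $\gamma_i(\xi)\ge\gamma_i(\xi_i',\xi_{-i})-\varepsilon$ for every player $i$ and every strategy $\xi'_i$ of player $i$. A vector $x\in\mathbb R^N$ is a *sunspot equilibrium payoff* if there are $\varepsilon_k>0$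 with $\varepsilon_k\to0$ and sunspot $\varepsilon_k$-equilibria $\xi^{(k)}$ with $\gamma(\xi^{(k)})\to x$. *Normal players.* Let $I_0=I$, $I_{l+1}=\{i\in I_l:\ \text{there is } j\in I_l,\ j\ne i,\ \text{with } r^j_i\le 0\}$, and $I_*=\bigcap_l I_l$. Order the players so that $I_*=\{1,\dots,n\}$, and let $\widehat R$ be the $n\times n$ matrix with entries $\widehat R_{ij}=r^j_i$ for $i,j\in I_*$. *$M$-matrices.* An $n\times n$ real matrix $R$ is a *$Q$-matrix* if for every $q\in\mathbb R^n$ there are $w,z\in\mathbb R^n_{\ge0}$ with $w=q+Rz$ and, for every $i$, $z_i=0$ or $w_i=0$. Here a $Q$-matrix is called an *$M$-matrix* if each of its rows and each of its columns has exactly one positive entry. **Theorem.** If $\widehat R$ is an $M$-matrix, then every vector in $$\operatorname{conv}\{r^1,\dots,r^n\}\cap\mathbb R^N_{\ge0}$$ is a sunspot equilibrium payoff. -/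

import Mathlib

open MeasureTheory Filter Topology

/-- A quitting game with player set `Fin N`: a terminal payoff vector in `[-1,1]^N` for every
set `S` of players who quit at the first stage at which somebody quits; `S = ∅` means that nobody
ever quits. -/
structure QuittingGame (N : ℕ) where
  payoff : Finset (Fin N) → Fin N → ℝ
  payoff_mem : ∀ S i, payoff S i ∈ Set.Icc (-1 : ℝ) 1

/-- A strategy of one player in the game with a public correlation device. Stages are numbered
`0, 1, 2, …`; at stage `t` the players have observed the signals of stages `0, …, t`, and
`quit t h` is the probability of quitting at stage `t` after the signals `h`, provided nobody
has quit before. -/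
structure SunspotStrategy where
  quit : (t : ℕ) → (Fin (t + 1) → unitInterval) → unitInterval
  measurable_quit : ∀ t, Measurable (quit t)

/-- The law of the sequence of public signals: independent, uniform on `[0,1]`. -/
noncomputable def signalLaw : Measure (ℕ → unitInterval) :=
  Measure.infinitePi fun _ : ℕ => (volume : Measure unitInterval)

namespace SunspotStrategy

/-- The probability of quitting at stage `t` along the signal sequence `s`. -/
def quitAt (σ : SunspotStrategy) (s : ℕ → unitInterval) (t : ℕ) : ℝ :=
  σ.quit t fun k => s k

end SunspotStrategy

namespace QuittingGame

variable {N : ℕ}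

/-- Given the signals `s` and that nobody quit before stage `t`, the probability that the set of
players who quit at stage `t` is exactly `S` (the players randomize independently). -/
noncomputable def stageProb (ξ : Fin N → SunspotStrategy) (s : ℕ → unitInterval) (t : ℕ)
    (S : Finset (Fin N)) : ℝ :=
  (∏ i ∈ S, (ξ i).quitAt s t) * ∏ i ∈ Sᶜ, (1 - (ξ i).quitAt s t)

/-- Given the signals `s`, the probability that nobody quits before stage `t`. -/
noncomputable def surviveProb (ξ : Fin N → SunspotStrategy) (s : ℕ → unitInterval) (t : ℕ) : ℝ :=
  ∏ u ∈ Finset.range t, stageProb ξ s u ∅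

/-- Given the signals `s`, the law of the terminal set `S*`: a nonempty `S` is the set of players
who quit at the first stage, for some `t`, at which somebody quits; `S* = ∅` is the event that
nobody ever quits, the decreasing intersection of the events that nobody quits before `t`. -/
noncomputable def terminalProb (ξ : Fin N → SunspotStrategy) (s : ℕ → unitInterval)
    (S : Finset (Fin N)) : ℝ :=
  if S = ∅ then ⨅ t, surviveProb ξ s t
  else ∑' t, surviveProb ξ s t * stageProb ξ s t S

/-- The expected payoff vector `γ(ξ) = E_ξ[r^{S*}]`. -/
noncomputable def expectedPayoff (G : QuittingGame N) (ξ : Fin N → SunspotStrategy) :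
    Fin N → ℝ :=
  fun i => ∫ s, ∑ S : Finset (Fin N), terminalProb ξ s S * G.payoff S i ∂signalLaw

/-- `ξ` is a sunspot `ε`-equilibrium: no player gains more than `ε` by a unilateral deviation. -/
def IsSunspotEquilibrium (G : QuittingGame N) (ε : ℝ) (ξ : Fin N → SunspotStrategy) : Prop :=
  ∀ (i : Fin N) (σ : SunspotStrategy),
    G.expectedPayoff (Function.update ξ i σ) i - ε ≤ G.expectedPayoff ξ i

/-- `x` is a sunspot equilibrium payoff: a limit, as `ε → 0`, of payoffs of sunspot
`ε`-equilibria. -/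
def IsSunspotEquilibriumPayoff (G : QuittingGame N) (x : Fin N → ℝ) : Prop :=
  ∃ (ε : ℕ → ℝ) (ξ : ℕ → Fin N → SunspotStrategy),
    (∀ k, 0 < ε k) ∧ Tendsto ε atTop (𝓝 0) ∧
    (∀ k, G.IsSunspotEquilibrium (ε k) (ξ k)) ∧
    Tendsto (fun k => G.expectedPayoff (ξ k)) atTop (𝓝 x)

open Classical in
/-- The sets `I_0 = I` and
`I_{l+1} = {i ∈ I_l | some j ∈ I_l, j ≠ i, gives i a nonpositive payoff by quitting alone}`. -/
noncomputable def normalStage (G : QuittingGame N) : ℕ → Finset (Fin N)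
  | 0 => Finset.univ
  | l + 1 => (G.normalStage l).filter
      fun i => ∃ j ∈ G.normalStage l, j ≠ i ∧ G.payoff {j} i ≤ 0

open Classical in
/-- The set `I_* = ⋂ l, I_l` of normal players. -/
noncomputable def normalPlayers (G : QuittingGame N) : Finset (Fin N) :=
  Finset.univ.filter fun i => ∀ l, i ∈ G.normalStage l

/-- The square matrix indexed by the normal players, whose column `j` is the payoff vector of
`j` quitting alone, restricted to the normal players. -/
noncomputable def normalMatrix (G : QuittingGame N) :
    Matrix G.normalPlayers G.normalPlayers ℝ :=
  Matrix.of fun i j => G.payoff {(j : Fin N)} (i : Fin N)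

end QuittingGame

namespace Matrix

/-- A `Q`-matrix: for every `q` the linear complementarity problem `w = q + R z`, `w, z ≥ 0`,
`z i = 0` or `w i = 0` for all `i`, has a solution. -/
def IsQMatrix {ι : Type*} [Fintype ι] (R : Matrix ι ι ℝ) : Prop :=
  ∀ q : ι → ℝ, ∃ w z : ι → ℝ,
    (∀ i, 0 ≤ w i) ∧ (∀ i, 0 ≤ z i) ∧ w = q + R *ᵥ z ∧ ∀ i, z i = 0 ∨ w i = 0

/-- An `M`-matrix in the sense used for matrices with zero diagonal: a `Q`-matrix with exactly one
positive entry in every row and in every column. -/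
def IsQuittingMMatrix {ι : Type*} [Fintype ι] (R : Matrix ι ι ℝ) : Prop :=
  R.IsQMatrix ∧ (∀ i, ∃! j, 0 < R i j) ∧ ∀ j, ∃! i, 0 < R i j

end Matrix

/-! Write `R` for the matrix of the normal players. The `Q`-property gives `z ≥ 0` with `R z > 0`;
together with the sign pattern this forces `R⁻¹ ≥ 0`. The normalized columns `α k` of `R⁻¹` are
probability vectors, and `y k = ∑ j, α k j • r^j` gives `c k > 0` to the normal player `k`, zero to
the other normal players and a nonnegative amount to everybody else. Each `x` of the theorem is a
convex combination of the `y k` (`exists_vertices`).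

Let `π k` be the column of the positive entry of row `k`. If `π k` alone quits with small
probability `ε`, the payoff `y k` is preserved by the continuation payoff `(y k - ε r^{π k}) / (1 -
ε)`. Its normal coordinates are nonnegative, because the only positive entry of column `π k` lies in
row `k`, where `c k` leaves room. So it is again an average of the `y l`, and the public signal
draws the next state `l` accordingly. Player `π k` has payoff zero in state `k` and is indifferent;
any other player who quits gets zero unless `π k` quits too, an event of probability `ε`.

The designated player might still keep the game alive by never quitting. A jump of probability `ε ^
2` to a state `σ k` outside `{k, π k}` passes the duty to somebody else and leaves the payoff of `π
k` at zero. Comparison with superharmonic functions of the state (`integral_terminalProb_le`) then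
bounds all payoffs up to `ε` (`exists_sunspotEquilibrium`). -/

instance : IsProbabilityMeasure signalLaw := by
  unfold signalLaw; infer_instance

/-! ### Measurability and independence of the signals -/

namespace SunspotStrategy

lemma quitAt_nonneg (σ : SunspotStrategy) (s : ℕ → unitInterval) (t : ℕ) : 0 ≤ σ.quitAt s t :=
  (σ.quit t fun k => s k).2.1

lemma quitAt_le_one (σ : SunspotStrategy) (s : ℕ → unitInterval) (t : ℕ) : σ.quitAt s t ≤ 1 :=
  (σ.quit t fun k => s k).2.2

lemma measurable_quitAt (σ : SunspotStrategy) (t : ℕ) : Measurable fun s => σ.quitAt s t :=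
  ((σ.measurable_quit t).comp (by fun_prop :
    Measurable fun (s : ℕ → unitInterval) (k : Fin (t + 1)) => s k)).subtype_val

lemma dependsOn_quitAt (σ : SunspotStrategy) (t : ℕ) :
    DependsOn (fun s => σ.quitAt s t) (Set.Iic t) := fun s s' h => by
  have : (fun k : Fin (t + 1) => s k) = fun k : Fin (t + 1) => s' k :=
    funext fun k => h k (Nat.lt_succ_iff.1 k.2)
  simp only [quitAt, this]

end SunspotStrategy

/-- The signal of stage `t + 1` is independent of everything determined by the signals up to
stage `t`. -/
lemma integral_mul_signal_succ {t : ℕ} {g : (ℕ → unitInterval) → ℝ} {φ : unitInterval → ℝ}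
    (hg : Measurable g) (hgt : DependsOn g (Set.Iic t)) (hφ : Measurable φ) :
    ∫ s, g s * φ (s (t + 1)) ∂signalLaw = (∫ s, g s ∂signalLaw) * ∫ u, φ u := by
  have hind := (ProbabilityTheory.iIndepFun_infinitePi
    (P := fun _ : ℕ => (volume : Measure unitInterval)) (X := fun _ u => u)
    (fun _ => measurable_id)).indepFun_finset (Finset.Iic t) {t + 1} (by simp)
    (fun i => measurable_pi_apply i)
  -- Padding a finite history by `0` does not affect `g`, which reads only coordinates up to `t`;
  -- hence `g` factors through the history.
  let ext : (Finset.Iic t → unitInterval) → ℕ → unitInterval :=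
    fun h k => if hk : k ∈ Finset.Iic t then h ⟨k, hk⟩ else 0
  have hext : Measurable ext := by
    refine measurable_pi_lambda _ fun k => ?_
    by_cases hk : k ∈ Finset.Iic t
    · simpa only [ext, hk, dif_pos] using measurable_pi_apply _
    · simp only [ext, hk, dif_neg, not_false_eq_true, measurable_const]
  have hind' := hind.comp (φ := fun h => g (ext h))
    (ψ := fun h : ({t + 1} : Finset ℕ) → unitInterval => φ (h ⟨t + 1, by simp⟩))
    (hg.comp hext) (hφ.comp (measurable_pi_apply _))
  have hgs : ∀ s : ℕ → unitInterval, g (ext fun i : Finset.Iic t => s i) = g s := fun s =>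
    hgt fun k hk => by simp [ext, show k ≤ t from hk]
  have hlaw : ∫ s, φ (s (t + 1)) ∂signalLaw = ∫ u, φ u := by
    rw [← integral_map (φ := fun s : ℕ → unitInterval => s (t + 1))
      (measurable_pi_apply _).aemeasurable hφ.aestronglyMeasurable]
    unfold signalLaw
    rw [Measure.infinitePi_map_eval]
  rw [← hlaw]
  have hind'' : ProbabilityTheory.IndepFun g (fun s => φ (s (t + 1))) signalLaw := by
    rw [show g = (fun h => g (ext h)) ∘ fun (s : ℕ → unitInterval) (i : Finset.Iic t) => s i from
      funext fun s => (hgs s).symm]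
    exact hind'
  exact hind''.integral_fun_mul_eq_mul_integral hg.aestronglyMeasurable
    (hφ.comp (measurable_pi_apply (t + 1))).aestronglyMeasurable

/-! ### Outcome probabilities of the game and of its truncations -/

namespace QuittingGame

variable {N : ℕ}

section Probabilities

variable (ξ : Fin N → SunspotStrategy) (s : ℕ → unitInterval) (t : ℕ) (S : Finset (Fin N))

lemma stageProb_nonneg : 0 ≤ stageProb ξ s t S :=
  mul_nonneg (Finset.prod_nonneg fun i _ => (ξ i).quitAt_nonneg s t)
    (Finset.prod_nonneg fun i _ => sub_nonneg.2 ((ξ i).quitAt_le_one s t))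

lemma sum_stageProb : ∑ S, stageProb ξ s t S = 1 := by
  simp only [stageProb]
  rw [← Fintype.prod_add]
  simp

lemma stageProb_le_one : stageProb ξ s t S ≤ 1 := by
  rw [← sum_stageProb ξ s t]
  exact Finset.single_le_sum (fun S _ => stageProb_nonneg ξ s t S) (Finset.mem_univ S)

lemma surviveProb_nonneg : 0 ≤ surviveProb ξ s t :=
  Finset.prod_nonneg fun _ _ => stageProb_nonneg ..

lemma surviveProb_succ : surviveProb ξ s (t + 1) = surviveProb ξ s t * stageProb ξ s t ∅ :=
  Finset.prod_range_succ ..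

lemma surviveProb_le_one : surviveProb ξ s t ≤ 1 :=
  Finset.prod_le_one (fun _ _ => stageProb_nonneg ..) fun _ _ => stageProb_le_one ..

lemma antitone_surviveProb : Antitone (surviveProb ξ s) :=
  antitone_nat_of_succ_le fun t => by
    rw [surviveProb_succ]
    exact mul_le_of_le_one_right (surviveProb_nonneg ..) (stageProb_le_one ..)

lemma measurable_stageProb : Measurable fun s => stageProb ξ s t S := by
  have := fun i => (ξ i).measurable_quitAt t
  unfold stageProb
  fun_prop

lemma measurable_surviveProb : Measurable fun s => surviveProb ξ s t := by
  have := fun u => measurable_stageProb ξ u ∅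
  unfold surviveProb
  fun_prop

lemma dependsOn_stageProb : DependsOn (fun s => stageProb ξ s t S) (Set.Iic t) := by
  intro s s' h
  simp only [stageProb, fun i => (ξ i).dependsOn_quitAt t h]

lemma dependsOn_surviveProb : DependsOn (fun s => surviveProb ξ s t) (Set.Iio t) := by
  intro s s' h
  refine Finset.prod_congr rfl fun u hu => dependsOn_stageProb ξ u ∅ fun i hi => h i ?_
  exact lt_of_le_of_lt hi (Finset.mem_range.1 hu)

/-- Given the signals, the law of the outcome of the game stopped before stage `t`. -/
noncomputable def stoppedProb (ξ : Fin N → SunspotStrategy) (s : ℕ → unitInterval) (t : ℕ)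
    (S : Finset (Fin N)) : ℝ :=
  if S = ∅ then surviveProb ξ s t
  else ∑ u ∈ Finset.range t, surviveProb ξ s u * stageProb ξ s u S

lemma stoppedProb_nonneg : 0 ≤ stoppedProb ξ s t S := by
  unfold stoppedProb
  split_ifs
  · exact surviveProb_nonneg ..
  · exact Finset.sum_nonneg fun u _ =>
      mul_nonneg (surviveProb_nonneg ..) (stageProb_nonneg ..)

/-- The mass still alive before stage `t` is booked under `∅`; one more stage takes it out and
redistributes it by the law of that stage. -/
lemma sum_stoppedProb_mul_succ (c : Finset (Fin N) → ℝ) :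
    ∑ S, stoppedProb ξ s (t + 1) S * c S =
      ∑ S, stoppedProb ξ s t S * c S - surviveProb ξ s t * c ∅ +
        surviveProb ξ s t * ∑ S, stageProb ξ s t S * c S := by
  have h : ∀ S, stoppedProb ξ s (t + 1) S * c S = stoppedProb ξ s t S * c S -
      (if S = ∅ then surviveProb ξ s t * c ∅ else 0) +
        surviveProb ξ s t * (stageProb ξ s t S * c S) := by
    intro S
    by_cases hS : S = ∅
    · subst hS
      simp [stoppedProb, surviveProb_succ]; ring
    · simp [stoppedProb, hS, Finset.sum_range_succ]; ring
  simp_rw [h]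
  rw [Finset.sum_add_distrib, Finset.sum_sub_distrib, Finset.mul_sum]
  simp

lemma sum_stoppedProb : ∑ S, stoppedProb ξ s t S = 1 := by
  induction t with
  | zero =>
    have : ∀ S, stoppedProb ξ s 0 S = if S = ∅ then 1 else 0 := fun S => by
      simp [stoppedProb, surviveProb]
    simp [this]
  | succ t ih =>
    have := sum_stoppedProb_mul_succ ξ s t fun _ => 1
    simp only [mul_one] at this
    rw [this, ih, sum_stageProb]; ring

lemma stoppedProb_le_one : stoppedProb ξ s t S ≤ 1 := by
  rw [← sum_stoppedProb ξ s t]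
  exact Finset.single_le_sum (fun S _ => stoppedProb_nonneg ξ s t S) (Finset.mem_univ S)

lemma measurable_stoppedProb : Measurable fun s => stoppedProb ξ s t S := by
  have h := fun u => measurable_stageProb ξ u S
  have h' := measurable_surviveProb ξ
  unfold stoppedProb
  split_ifs
  · exact h' t
  · fun_prop

lemma tendsto_stoppedProb :
    Tendsto (fun t => stoppedProb ξ s t S) atTop (𝓝 (terminalProb ξ s S)) := by
  unfold terminalProb
  split_ifs with hS
  · simp only [stoppedProb, hS, if_true]
    exact tendsto_atTop_ciInf (antitone_surviveProb ξ s)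
      ⟨0, by rintro _ ⟨t, rfl⟩; exact surviveProb_nonneg ξ s t⟩
  · have h : ∀ t, stoppedProb ξ s t S =
        ∑ u ∈ Finset.range t, surviveProb ξ s u * stageProb ξ s u S := fun t => by
      simp [stoppedProb, hS]
    simp_rw [h]
    refine Summable.tendsto_sum_tsum_nat (summable_of_sum_range_le (c := 1) (fun u =>
      mul_nonneg (surviveProb_nonneg ..) (stageProb_nonneg ..)) fun t => ?_)
    rw [← h]
    exact stoppedProb_le_one ξ s t S

end Probabilities

lemma abs_sum_stoppedProb_mul_le {c : Finset (Fin N) → ℝ} (hc : ∀ S, |c S| ≤ 1)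
    (ξ : Fin N → SunspotStrategy) (s : ℕ → unitInterval) (t : ℕ) :
    |∑ S, stoppedProb ξ s t S * c S| ≤ 1 := by
  refine (Finset.abs_sum_le_sum_abs _ _).trans ?_
  rw [← sum_stoppedProb ξ s t]
  refine Finset.sum_le_sum fun S _ => ?_
  rw [abs_mul, abs_of_nonneg (stoppedProb_nonneg ..)]
  exact mul_le_of_le_one_right (stoppedProb_nonneg ..) (hc S)

lemma tendsto_integral_stoppedProb {c : Finset (Fin N) → ℝ} (hc : ∀ S, |c S| ≤ 1)
    (ξ : Fin N → SunspotStrategy) :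
    Tendsto (fun t => ∫ s, ∑ S, stoppedProb ξ s t S * c S ∂signalLaw) atTop
      (𝓝 (∫ s, ∑ S, terminalProb ξ s S * c S ∂signalLaw)) := by
  refine tendsto_integral_of_dominated_convergence (fun _ => 1) (fun t => ?_)
    (integrable_const _) (fun t => .of_forall fun s => abs_sum_stoppedProb_mul_le hc ξ s t)
    (.of_forall fun s => tendsto_finsetSum _ fun S _ =>
      (tendsto_stoppedProb ξ s S).mul_const (c S))
  have := measurable_stoppedProb ξ t
  exact (by fun_prop : Measurable fun s => ∑ S, stoppedProb ξ s t S * c S).aestronglyMeasurable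

/-! ### Markov chains driven by the signals, and comparison of payoffs -/

/-- A finite-state Markov chain driven by the public signals. -/
structure SignalChain (K : Type*) [MeasurableSpace K] where
  init : unitInterval → K
  step : K → unitInterval → K
  measurable_init : Measurable init
  measurable_step : ∀ k, Measurable (step k)

namespace SignalChain

variable {K : Type*} [MeasurableSpace K] (C : SignalChain K)

/-- The state at stage `t` along the signal sequence `s`. -/
def state (s : ℕ → unitInterval) : ℕ → K
  | 0 => C.init (s 0)
  | t + 1 => C.step (state s t) (s (t + 1))

lemma dependsOn_state (t : ℕ) : DependsOn (fun s => C.state s t) (Set.Iic t) := by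
  induction t with
  | zero => intro s s' h; simp only [state, h 0 (by simp)]
  | succ t ih =>
    intro s s' h
    have := ih fun i hi => h i (le_trans hi (Nat.le_succ t))
    dsimp only at this
    simp only [state, h (t + 1) (by simp), this]

variable [Fintype K] [DiscreteMeasurableSpace K]

lemma measurable_state (t : ℕ) : Measurable fun s => C.state s t := by
  induction t with
  | zero => exact C.measurable_init.comp (measurable_pi_apply 0)
  | succ t ih =>
    have : Measurable (Function.uncurry C.step) :=
      measurable_from_prod_countable_right C.measurable_step
    exact this.comp (ih.prodMk (measurable_pi_apply (t + 1)))

lemma integral_mul_state_succ {t : ℕ} {g : (ℕ → unitInterval) → ℝ} (hg : Measurable g)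
    (hgt : DependsOn g (Set.Iic t)) (hgi : ∀ s, |g s| ≤ 1) (W : K → ℝ) :
    ∫ s, g s * W (C.state s (t + 1)) ∂signalLaw =
      ∫ s, g s * (∫ u, W (C.step (C.state s t) u)) ∂signalLaw := by
  classical
  have hW : Measurable W := measurable_of_countable W
  have hst := C.measurable_state t
  -- Splitting by the state at stage `t` turns the integrand into products of a function of the past
  -- and a function of the fresh signal, so independence applies to each term.
  let gk : K → (ℕ → unitInterval) → ℝ := fun k s => g s * if C.state s t = k then 1 else 0
  have hgk : ∀ k, Measurable (gk k) := fun k => by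
    refine hg.mul (Measurable.ite ?_ measurable_const measurable_const)
    exact hst (measurableSet_singleton k)
  have hgk1 : ∀ k s, |gk k s| ≤ 1 := fun k s => by
    simp only [gk]; split_ifs <;> simp [hgi s]
  have hgkt : ∀ k, DependsOn (gk k) (Set.Iic t) := fun k s s' h => by
    have h1 := C.dependsOn_state t h
    dsimp only at h1
    simp only [gk, hgt h, h1]
  have hbd : ∃ B, ∀ k, |W k| ≤ B := ⟨∑ k, |W k|, fun k =>
    Finset.single_le_sum (f := fun k => |W k|) (fun _ _ => abs_nonneg _) (Finset.mem_univ k)⟩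
  obtain ⟨B, hB⟩ := hbd
  have hint : ∀ k, Integrable (fun s => gk k s * W (C.step k (s (t + 1)))) signalLaw := fun k => by
    refine Integrable.of_bound (C := B) ((hgk k).mul (hW.comp ((C.measurable_step k).comp
      (measurable_pi_apply (t + 1))))).aestronglyMeasurable (.of_forall fun s => ?_)
    rw [Real.norm_eq_abs, abs_mul]
    calc _ ≤ 1 * B := mul_le_mul (hgk1 k s) (hB _) (abs_nonneg _) zero_le_one
      _ = B := one_mul B
  have hint' : ∀ k, Integrable (gk k) signalLaw := fun k =>
    Integrable.of_bound (C := 1) (hgk k).aestronglyMeasurable (.of_forall (hgk1 k))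
  have h1 : ∀ s, g s * W (C.state s (t + 1)) = ∑ k, gk k s * W (C.step k (s (t + 1))) := fun s => by
    simp [gk, state]
  have h2 : ∀ s, g s * ∫ u, W (C.step (C.state s t) u) = ∑ k, gk k s * ∫ u, W (C.step k u) :=
    fun s => by simp [gk]
  simp_rw [h1, h2]
  rw [integral_finsetSum _ fun k _ => hint k,
    integral_finsetSum _ fun k _ => (hint' k).mul_const _]
  refine Finset.sum_congr rfl fun k _ => ?_
  rw [integral_mul_signal_succ (φ := fun u => W (C.step k u)) (hgk k) (hgkt k)
    (hW.comp (C.measurable_step k)), integral_mul_const]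

/-- Survival up to stage `t + 1` is decided by the signals up to `t`, so the signal of stage `t + 1`
can be averaged out first. -/
lemma integral_surviveProb_mul_state_succ (ξ : Fin N → SunspotStrategy) (W : K → ℝ) (t : ℕ) :
    ∫ s, surviveProb ξ s (t + 1) * W (C.state s (t + 1)) ∂signalLaw =
      ∫ s, surviveProb ξ s t * (stageProb ξ s t ∅ * (∫ u, W (C.step (C.state s t) u)))
        ∂signalLaw := by
  rw [C.integral_mul_state_succ (measurable_surviveProb ξ (t + 1)) (fun s s' h =>
    dependsOn_surviveProb ξ (t + 1) fun i hi => h i (Nat.lt_succ_iff.1 hi)) (fun s => ?_)]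
  · simp_rw [surviveProb_succ, mul_assoc]
  · rw [abs_of_nonneg (surviveProb_nonneg ..)]
    exact surviveProb_le_one ..

lemma integrable_surviveProb_mul (ξ : Fin N → SunspotStrategy) (W : K → ℝ) (t : ℕ) :
    Integrable (fun s => surviveProb ξ s t * W (C.state s t)) signalLaw := by
  refine Integrable.of_bound (C := ∑ k, |W k|) ((measurable_surviveProb ξ t).mul
    ((measurable_of_countable W).comp (C.measurable_state t))).aestronglyMeasurable
    (.of_forall fun s => ?_)
  rw [Real.norm_eq_abs, abs_mul, abs_of_nonneg (surviveProb_nonneg ..)]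
  calc _ ≤ 1 * ∑ k, |W k| := mul_le_mul (surviveProb_le_one ..) (Finset.single_le_sum
        (f := fun k => |W k|) (fun _ _ => abs_nonneg _) (Finset.mem_univ _))
        (abs_nonneg _) zero_le_one
    _ = _ := one_mul _

lemma integrable_surviveProb_mul_stageProb (ξ : Fin N → SunspotStrategy) (W : K → ℝ) (t : ℕ) :
    Integrable (fun s => surviveProb ξ s t *
      (stageProb ξ s t ∅ * W (C.state s t))) signalLaw := by
  refine (C.integrable_surviveProb_mul ξ W t).mono ((measurable_surviveProb ξ t).mul
    ((measurable_stageProb ξ t ∅).mul ((measurable_of_countable W).comp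
      (C.measurable_state t)))).aestronglyMeasurable (.of_forall fun s => ?_)
  rw [norm_mul, norm_mul, norm_mul]
  refine mul_le_mul_of_nonneg_left (mul_le_of_le_one_left (norm_nonneg _) ?_) (norm_nonneg _)
  rw [Real.norm_eq_abs, abs_of_nonneg (stageProb_nonneg ..)]
  exact stageProb_le_one ..

/-- If a potential on the states shrinks geometrically, the game almost surely ends. -/
lemma tendsto_integral_surviveProb (ξ : Fin N → SunspotStrategy) {g : K → ℝ} {r : ℝ}
    (hg : ∀ k, 1 ≤ g k) (hr0 : 0 ≤ r) (hr : r < 1)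
    (h : ∀ s t, stageProb ξ s t ∅ * ∫ u, g (C.step (C.state s t) u) ≤ r * g (C.state s t)) :
    Tendsto (fun t => ∫ s, surviveProb ξ s t ∂signalLaw) atTop (𝓝 0) := by
  have hle : ∀ t, ∫ s, surviveProb ξ s t * g (C.state s t) ∂signalLaw ≤
      r ^ t * ∫ s, surviveProb ξ s 0 * g (C.state s 0) ∂signalLaw := by
    intro t
    induction t with
    | zero => simp
    | succ t ih =>
      rw [C.integral_surviveProb_mul_state_succ, pow_succ', mul_assoc]
      refine le_trans ?_ (mul_le_mul_of_nonneg_left ih hr0)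
      rw [← integral_const_mul]
      refine integral_mono (C.integrable_surviveProb_mul_stageProb ξ
        (fun k => ∫ u, g (C.step k u)) t) ((C.integrable_surviveProb_mul ξ g t).const_mul r)
        fun s => ?_
      calc _ ≤ surviveProb ξ s t * (r * g (C.state s t)) :=
            mul_le_mul_of_nonneg_left (h s t) (surviveProb_nonneg ..)
        _ = r * (surviveProb ξ s t * g (C.state s t)) := by ring
  refine squeeze_zero (fun t => integral_nonneg fun s => surviveProb_nonneg ..) (fun t =>
    le_trans (integral_mono (by simpa using C.integrable_surviveProb_mul ξ (fun _ => 1) t)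
      (C.integrable_surviveProb_mul ξ g t) fun s => ?_) (hle t)) ?_
  · exact le_mul_of_one_le_right (surviveProb_nonneg ..) (hg _)
  · simpa using (tendsto_pow_atTop_nhds_zero_of_lt_one hr0 hr).mul_const _

/-- If the game almost surely ends, a superharmonic function of the state bounds the payoff. -/
lemma integral_terminalProb_le (ξ : Fin N → SunspotStrategy) {c : Finset (Fin N) → ℝ}
    (hc : ∀ S, |c S| ≤ 1) (W : K → ℝ)
    (hend : Tendsto (fun t => ∫ s, surviveProb ξ s t ∂signalLaw) atTop (𝓝 0))
    (h : ∀ s t, ∑ S, stageProb ξ s t S *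
      (if S = ∅ then ∫ u, W (C.step (C.state s t) u) else c S) ≤ W (C.state s t)) :
    ∫ s, ∑ S, terminalProb ξ s S * c S ∂signalLaw ≤ ∫ u, W (C.init u) := by
  have hintegrable : ∀ t, Integrable (fun s => ∑ S, stoppedProb ξ s t S * c S) signalLaw := fun t => by
    have := measurable_stoppedProb ξ t
    exact Integrable.of_bound (C := 1)
      (by fun_prop : Measurable fun s => ∑ S, stoppedProb ξ s t S * c S).aestronglyMeasurable
      (.of_forall fun s => abs_sum_stoppedProb_mul_le hc ξ s t)
  have hinit : ∫ s, W (C.init (s 0)) ∂signalLaw = ∫ u, W (C.init u) := by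
    rw [← integral_map (φ := fun s : ℕ → unitInterval => s 0)
      (f := fun u => W (C.init u)) (measurable_pi_apply _).aemeasurable
      ((measurable_of_countable W).comp C.measurable_init).aestronglyMeasurable]
    unfold signalLaw
    rw [Measure.infinitePi_map_eval]
  have hsurv : ∀ t, Integrable (fun s => surviveProb ξ s t) signalLaw := fun t => by
    simpa using C.integrable_surviveProb_mul ξ (fun _ => 1) t
  have hsub : ∀ t, Integrable (fun s => ∑ S, stoppedProb ξ s t S * c S
      - surviveProb ξ s t * c ∅) signalLaw := fun t => (hintegrable t).sub ((hsurv t).mul_const _)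
  -- The left side is the expected payoff of the stopped game with the surviving mass valued by `W`
  -- instead of `c ∅`. It equals the right side at `t = 0` and does not increase with `t`.
  have key : ∀ t, ∫ s, ∑ S, stoppedProb ξ s t S * c S ∂signalLaw
      - (∫ s, surviveProb ξ s t ∂signalLaw) * c ∅
      + ∫ s, surviveProb ξ s t * W (C.state s t) ∂signalLaw ≤ ∫ u, W (C.init u) := by
    intro t
    induction t with
    | zero =>
      have : ∀ s S, stoppedProb ξ s 0 S = if S = ∅ then 1 else 0 := fun s S => by
        simp [stoppedProb, surviveProb]
      simp [this, surviveProb, state, hinit]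
    | succ t ih =>
      refine le_trans ?_ ih
      have hA := C.integrable_surviveProb_mul_stageProb ξ (fun k => ∫ u, W (C.step k u)) t
      have hB := C.integrable_surviveProb_mul ξ W t
      rw [C.integral_surviveProb_mul_state_succ, ← integral_mul_const, ← integral_mul_const,
        ← integral_sub (hintegrable _) ((hsurv _).mul_const _),
        ← integral_sub (hintegrable _) ((hsurv _).mul_const _),
        ← integral_add (hsub _) hA, ← integral_add (hsub _) hB]
      refine integral_mono ((hsub _).add hA) ((hsub _).add hB) fun s => ?_
      have h1 : ∑ S, stageProb ξ s t S *
          (if S = ∅ then ∫ u, W (C.step (C.state s t) u) else c S) =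
          ∑ S, stageProb ξ s t S * c S - stageProb ξ s t ∅ * c ∅ +
            stageProb ξ s t ∅ * ∫ u, W (C.step (C.state s t) u) := by
        have : ∀ S, stageProb ξ s t S *
            (if S = ∅ then ∫ u, W (C.step (C.state s t) u) else c S) =
            stageProb ξ s t S * c S + if S = ∅ then
              stageProb ξ s t ∅ * (∫ u, W (C.step (C.state s t) u)) - stageProb ξ s t ∅ * c ∅
              else 0 := by
          intro S
          split_ifs with hS
          · subst hS; ring
          · ring
        simp_rw [this]
        rw [Finset.sum_add_distrib]
        simp only [Finset.sum_ite_eq', Finset.mem_univ, if_true]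
        ring
      have h2 := mul_le_mul_of_nonneg_left (h s t) (surviveProb_nonneg ξ s t)
      rw [h1] at h2
      simp only [sum_stoppedProb_mul_succ, surviveProb_succ]
      linarith
  have hbdd : Tendsto (fun t => ∫ s, surviveProb ξ s t * W (C.state s t) ∂signalLaw) atTop
      (𝓝 0) := by
    refine squeeze_zero_norm (a := fun t => (∫ s, surviveProb ξ s t ∂signalLaw) * ∑ k, |W k|)
      (fun t => ?_) (by simpa using hend.mul_const _)
    refine (norm_integral_le_integral_norm _).trans ?_
    rw [← integral_mul_const]
    refine integral_mono (C.integrable_surviveProb_mul ξ W t).norm ((hsurv t).mul_const _)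
      fun s => ?_
    dsimp only
    rw [Real.norm_eq_abs, abs_mul, abs_of_nonneg (surviveProb_nonneg ..)]
    exact mul_le_mul_of_nonneg_left (Finset.single_le_sum
      (f := fun k => |W k|) (fun _ _ => abs_nonneg _) (Finset.mem_univ _))
      (surviveProb_nonneg ..)
  have hlim := ((tendsto_integral_stoppedProb hc ξ).sub (hend.mul_const (c ∅))).add hbdd
  simpa using le_of_tendsto' hlim key

end SignalChain

end QuittingGame

/-! ### Sampling from a signal, and stages with at most two active players -/

/-- Every probability vector on a finite set is the law of a function of a uniform signal. -/
lemma exists_measurable_integral_eq_sum {K : Type*} [Fintype K] [MeasurableSpace K]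
    [DiscreteMeasurableSpace K] {p : K → ℝ} (hp : ∀ k, 0 ≤ p k) (hp1 : ∑ k, p k = 1) :
    ∃ f : unitInterval → K, Measurable f ∧ ∀ W : K → ℝ, ∫ u, W (f u) = ∑ k, p k * W k := by
  have hne : Nonempty K := by
    by_contra h
    rw [not_nonempty_iff] at h
    simp at hp1
  let μ : Measure K := ∑ k, ENNReal.ofReal (p k) • Measure.dirac k
  have hμ : IsProbabilityMeasure μ := ⟨by
    simp only [μ, Measure.coe_finsetSum, Finset.sum_apply, Measure.smul_apply, measure_univ,
      smul_eq_mul, mul_one]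
    rw [← ENNReal.ofReal_sum_of_nonneg fun k _ => hp k, hp1, ENNReal.ofReal_one]⟩
  obtain ⟨f, hf, hfμ⟩ := Measure.exists_measurable_map_eq μ
  refine ⟨f, hf, fun W => ?_⟩
  rw [← integral_map (φ := f) hf.aemeasurable (measurable_of_countable W).aestronglyMeasurable, hfμ,
    integral_finsetSum_measure fun k _ =>
      (integrable_dirac (by simp)).smul_measure ENNReal.ofReal_ne_top]
  refine Finset.sum_congr rfl fun k _ => ?_
  rw [integral_smul_measure, integral_dirac, ENNReal.toReal_ofReal (hp k), smul_eq_mul]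

/-- The law of a random set of independent elements only charges the subsets of the elements with
positive probability. -/
lemma sum_prod_mul_prod_compl_of_support {ι : Type*} [Fintype ι] [DecidableEq ι] {q : ι → ℝ}
    {A : Finset ι} (hq : ∀ j ∉ A, q j = 0) (d : Finset ι → ℝ) :
    ∑ S, ((∏ j ∈ S, q j) * ∏ j ∈ Sᶜ, (1 - q j)) * d S =
      ∑ S ∈ A.powerset, ((∏ j ∈ S, q j) * ∏ j ∈ A \ S, (1 - q j)) * d S := by
  rw [← Finset.sum_subset (Finset.subset_univ A.powerset)]
  · refine Finset.sum_congr rfl fun S hS => ?_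
    congr 2
    symm
    refine Finset.prod_subset (fun j hj => by simp at hj ⊢; exact hj.2) fun j hj hj' => ?_
    rw [hq j fun hjA => hj' (Finset.mem_sdiff.2 ⟨hjA, Finset.mem_compl.1 hj⟩), sub_zero]
  · intro S _ hS
    obtain ⟨j, hjS, hjA⟩ := Finset.not_subset.1 fun h => hS (Finset.mem_powerset.2 h)
    rw [Finset.prod_eq_zero hjS (hq j hjA), zero_mul, zero_mul]

namespace QuittingGame

variable {N : ℕ}

lemma sum_stageProb_mul_of_singleton {ξ : Fin N → SunspotStrategy} {s : ℕ → unitInterval} {t : ℕ}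
    {a : Fin N} (h : ∀ j, j ≠ a → (ξ j).quitAt s t = 0) (d : Finset (Fin N) → ℝ) :
    ∑ S, stageProb ξ s t S * d S =
      (1 - (ξ a).quitAt s t) * d ∅ + (ξ a).quitAt s t * d {a} := by
  unfold stageProb
  rw [sum_prod_mul_prod_compl_of_support (A := {a}) fun j hj => h j (by simpa using hj)]
  rw [show ({a} : Finset (Fin N)) = insert a ∅ from rfl,
    Finset.sum_powerset_insert (Finset.notMem_empty a)]
  simp

lemma sum_stageProb_mul_of_pair {ξ : Fin N → SunspotStrategy} {s : ℕ → unitInterval} {t : ℕ}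
    {a b : Fin N} (hab : a ≠ b) (h : ∀ j, j ≠ a → j ≠ b → (ξ j).quitAt s t = 0)
    (d : Finset (Fin N) → ℝ) :
    ∑ S, stageProb ξ s t S * d S =
      (1 - (ξ a).quitAt s t) * (1 - (ξ b).quitAt s t) * d ∅ +
      (1 - (ξ a).quitAt s t) * (ξ b).quitAt s t * d {b} +
      (ξ a).quitAt s t * (1 - (ξ b).quitAt s t) * d {a} +
      (ξ a).quitAt s t * (ξ b).quitAt s t * d {a, b} := by
  unfold stageProb
  rw [sum_prod_mul_prod_compl_of_support (A := {a, b}) fun j hj => by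
    simp only [Finset.mem_insert, Finset.mem_singleton, not_or] at hj; exact h j hj.1 hj.2]
  rw [Finset.sum_powerset_insert (by simpa using hab),
    show ({b} : Finset (Fin N)) = insert b ∅ from rfl,
    Finset.sum_powerset_insert (Finset.notMem_empty b),
    Finset.sum_powerset_insert (Finset.notMem_empty b)]
  have h1 : ({a, b} : Finset (Fin N)) \ {b} = {a} := by
    ext j; simp only [Finset.mem_sdiff, Finset.mem_insert, Finset.mem_singleton]; grind
  have h2 : ({b} : Finset (Fin N)) \ {a} = {b} := by
    ext j; simp only [Finset.mem_sdiff, Finset.mem_singleton]; grind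
  have h3 : ({b} : Finset (Fin N)) \ {a, b} = ∅ := by
    ext j; simp only [Finset.mem_sdiff, Finset.mem_insert, Finset.mem_singleton]; simp; grind
  simp [h1, h2, h3, Finset.prod_pair hab]
  ring

/-- If some player continues with probability `x`, the game survives the stage with probability at
most `x`. -/
lemma stageProb_empty_le {ξ : Fin N → SunspotStrategy} {s : ℕ → unitInterval} {t : ℕ}
    {a : Fin N} {x : ℝ} (h : (ξ a).quitAt s t = 1 - x) : stageProb ξ s t ∅ ≤ x := by
  have h0 : ∀ j, 0 ≤ 1 - (ξ j).quitAt s t := fun j => sub_nonneg.2 ((ξ j).quitAt_le_one s t)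
  simp only [stageProb, Finset.prod_empty, one_mul, Finset.compl_empty]
  rw [← Finset.mul_prod_erase _ _ (Finset.mem_univ a), h, sub_sub_cancel]
  refine mul_le_of_le_one_right (by have := h0 a; rw [h] at this; linarith)
    (Finset.prod_le_one (fun j _ => h0 j) fun j _ => ?_)
  linarith [(ξ j).quitAt_nonneg s t]

/-! ### Approximate equilibria from a Markov chain of payoffs -/

namespace SignalChain

variable {K : Type*} [MeasurableSpace K] [Fintype K] [DiscreteMeasurableSpace K]
  (C : SignalChain K)

open Classical in
/-- The profile in which, in state `k`, only player `a k` quits, with probability `ε`. -/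
noncomputable def profile (a : K → Fin N) (ε : unitInterval) (i : Fin N) : SunspotStrategy where
  -- The index `min k t` extends the history to an infinite sequence; the state at stage `t` never
  -- reads the padding.
  quit t h := if a (C.state (fun k => h ⟨min k t, Nat.lt_succ_iff.2 (min_le_right k t)⟩) t) = i
    then ε else 0
  measurable_quit t := by
    refine Measurable.ite ?_ measurable_const measurable_const
    exact ((C.measurable_state t).comp (measurable_pi_lambda
      (fun (h : Fin (t + 1) → unitInterval) (k : ℕ) => h ⟨min k t, _⟩)
      fun k => measurable_pi_apply _))
      (MeasurableSet.of_discrete (s := {k | a k = i}))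

open Classical in
lemma quitAt_profile (a : K → Fin N) (ε : unitInterval) (i : Fin N) (s : ℕ → unitInterval)
    (t : ℕ) : (C.profile a ε i).quitAt s t = if a (C.state s t) = i then (ε : ℝ) else 0 := by
  have h : C.state (fun k => s (min k t)) t = C.state s t :=
    C.dependsOn_state t fun k hk => by rw [min_eq_left hk]
  simp only [SunspotStrategy.quitAt, profile, h]
  split_ifs <;> rfl

end SignalChain

/-- Suppose that in each state `k` a single player `a k` quits with small probability `ε`, that the
payoff vectors `y k` are nonnegative and preserved by this rule together with a transition matrix
`P`, and that player `a k` is indifferent in state `k`. Perturbing `P` by a rare jump to `σ k ≠ k`,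
which ensures termination even if `a k` never quits, yields an approximate sunspot equilibrium. -/
lemma exists_sunspotEquilibrium {K : Type*} [Fintype K] [DecidableEq K] [MeasurableSpace K]
    [DiscreteMeasurableSpace K] (G : QuittingGame N) (hG : ∀ i : Fin N, G.payoff {i} i = 0)
    {a : K → Fin N} (ha : Function.Injective a) {y : K → Fin N → ℝ} (hy0 : ∀ k i, 0 ≤ y k i)
    (hy1 : ∀ k i, y k i ≤ 1) {σ : K → K} (hσ : ∀ k, σ k ≠ k) (hya : ∀ k, y k (a k) = 0)
    (hyσ : ∀ k, y (σ k) (a k) = 0) {ε : ℝ} (hε0 : 0 < ε) (hε1 : ε < 1) {P : K → K → ℝ}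
    (hP0 : ∀ k l, 0 ≤ P k l) (hP1 : ∀ k, ∑ l, P k l = 1)
    (hyP : ∀ k i, y k i = ε * G.payoff {a k} i + (1 - ε) * ∑ l, P k l * y l i)
    {p : K → ℝ} (hp0 : ∀ k, 0 ≤ p k) (hp1 : ∑ k, p k = 1) :
    ∃ ξ : Fin N → SunspotStrategy, G.IsSunspotEquilibrium (2 * ε) ξ ∧
      ∀ i, |G.expectedPayoff ξ i - ∑ k, p k * y k i| ≤ ε := by
  -- The jump has probability `ε ^ 2`, of smaller order than the quitting probability `ε`, so that
  -- termination absorbs the error it causes.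
  have hMex : ∀ k, ∃ f : unitInterval → K, Measurable f ∧ ∀ W : K → ℝ, ∫ u, W (f u) =
      (1 - ε ^ 2) * ∑ l, P k l * W l + ε ^ 2 * W (σ k) := by
    intro k
    obtain ⟨f, hf, hfW⟩ := exists_measurable_integral_eq_sum
      (p := fun l => (1 - ε ^ 2) * P k l + if l = σ k then ε ^ 2 else 0)
      (fun l => add_nonneg (mul_nonneg (by nlinarith) (hP0 k l)) (by split_ifs <;> positivity))
      (by rw [Finset.sum_add_distrib, ← Finset.mul_sum, hP1]; simp)
    refine ⟨f, hf, fun W => ?_⟩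
    rw [hfW]
    simp only [add_mul, Finset.sum_add_distrib, mul_assoc, ← Finset.mul_sum]
    simp
  choose f hf hfW using hMex
  obtain ⟨f₀, hf₀, hf₀W⟩ := exists_measurable_integral_eq_sum hp0 hp1
  let C : SignalChain K := ⟨f₀, f, hf₀, hf⟩
  have hstep : ∀ k (W : K → ℝ), ∫ u, W (C.step k u) =
      (1 - ε ^ 2) * ∑ l, P k l * W l + ε ^ 2 * W (σ k) := hfW
  have hinit : ∀ W : K → ℝ, ∫ u, W (C.init u) = ∑ k, p k * W k := hf₀W
  let ξ : Fin N → SunspotStrategy := C.profile a ⟨ε, hε0.le, hε1.le⟩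
  have hξ : ∀ i s t, (ξ i).quitAt s t = if a (C.state s t) = i then ε else 0 := fun i s t => by
    simp only [ξ, C.quitAt_profile]
  have hPy0 : ∀ k i, 0 ≤ ∑ l, P k l * y l i := fun k i =>
    Finset.sum_nonneg fun l _ => mul_nonneg (hP0 k l) (hy0 l i)
  have hPy1 : ∀ k i, ∑ l, P k l * y l i ≤ 1 := fun k i => by
    rw [← hP1 k]
    exact Finset.sum_le_sum fun l _ => mul_le_of_le_one_right (hP0 k l) (hy1 l i)
  have hPya : ∀ k, ∑ l, P k l * y l (a k) = 0 := fun k => by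
    have := hyP k (a k)
    rw [hya, hG, mul_zero, zero_add] at this
    exact (mul_eq_zero.1 this.symm).resolve_left (by linarith)
  have hsum : ∀ k i e, ∑ l, P k l * (y l i + e) = ∑ l, P k l * y l i + e := fun k i e => by
    simp only [mul_add, Finset.sum_add_distrib, ← Finset.sum_mul, hP1, one_mul]
  have hpay : ∀ S i, |G.payoff S i| ≤ 1 := fun S i => abs_le.2 (G.payoff_mem S i)
  have hother : ∀ i (τ : SunspotStrategy) j s t, j ≠ i → j ≠ a (C.state s t) →
      ((Function.update ξ i τ) j).quitAt s t = 0 := fun i τ j s t hji hja => by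
    rw [Function.update_of_ne hji, hξ, if_neg (Ne.symm hja)]
  have hend : ∀ i (τ : SunspotStrategy), Tendsto
      (fun t => ∫ s, surviveProb (Function.update ξ i τ) s t ∂signalLaw) atTop (𝓝 0) := by
    intro i τ
    -- The potential is higher where the deviator `i` is the designated quitter. There only the jump
    -- is sure to help: the expected next value is at most `(1 - ε ^ 2) * (1 + ε) + ε ^ 2 = 1 + ε -
    -- ε ^ 3`. Elsewhere the designated player quits, leaving at most `(1 - ε) * (1 + ε)`. Both fit
    -- the rate `1 - ε ^ 3 / 2`.
    let g : K → ℝ := fun k => if a k = i then 1 + ε else 1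
    have hg1 : ∀ k, 1 ≤ g k := fun k => by simp only [g]; split_ifs <;> linarith
    have hg2 : ∀ k, g k ≤ 1 + ε := fun k => by simp only [g]; split_ifs <;> linarith
    have hPg : ∀ k, ∑ l, P k l * g l ≤ 1 + ε := fun k => by
      calc _ ≤ ∑ l, P k l * (1 + ε) :=
            Finset.sum_le_sum fun l _ => mul_le_mul_of_nonneg_left (hg2 l) (hP0 k l)
        _ = 1 + ε := by rw [← Finset.sum_mul, hP1, one_mul]
    have hε2 : ε ^ 2 ≤ 1 := by nlinarith
    have hε3 : 0 < ε ^ 3 := by positivity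
    refine C.tendsto_integral_surviveProb _ (g := g) (r := 1 - ε ^ 3 / 2) hg1
      (by nlinarith) (by linarith) fun s t => ?_
    rw [hstep]
    have hPgk := hPg (C.state s t)
    have hX : (1 - ε ^ 2) * ∑ l, P (C.state s t) l * g l + ε ^ 2 * g (σ (C.state s t)) ≤
        1 + ε := by nlinarith [hg2 (σ (C.state s t))]
    by_cases hk : a (C.state s t) = i
    · have h1 : g (σ (C.state s t)) = 1 := if_neg fun h => hσ _ (ha (h.trans hk.symm))
      have h2 : g (C.state s t) = 1 + ε := if_pos hk
      rw [h1, h2]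
      rw [h1] at hX
      calc _ ≤ 1 * ((1 - ε ^ 2) * ∑ l, P (C.state s t) l * g l + ε ^ 2 * 1) := by
            refine mul_le_mul_of_nonneg_right (stageProb_le_one ..) ?_
            have : 0 ≤ ∑ l, P (C.state s t) l * g l :=
              Finset.sum_nonneg fun l _ => mul_nonneg (hP0 _ l) (zero_le_one.trans (hg1 l))
            nlinarith
        _ ≤ _ := by nlinarith
    · have h2 : g (C.state s t) = 1 := if_neg hk
      have h3 : stageProb (Function.update ξ i τ) s t ∅ ≤ 1 - ε := by
        refine stageProb_empty_le (a := a (C.state s t)) ?_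
        rw [Function.update_of_ne hk, hξ, if_pos rfl, sub_sub_cancel]
      rw [h2]
      calc _ ≤ stageProb (Function.update ξ i τ) s t ∅ * (1 + ε) :=
            mul_le_mul_of_nonneg_left hX (stageProb_nonneg ..)
        _ ≤ (1 - ε) * (1 + ε) := mul_le_mul_of_nonneg_right h3 (by linarith)
        _ ≤ _ := by nlinarith
  have hupper : ∀ i τ, G.expectedPayoff (Function.update ξ i τ) i ≤ ∑ k, p k * y k i + ε := by
    intro i τ
    -- The added constant `ε` pays for the jumps: a stage ended with probability `ε` by another
    -- player releases `ε * ε` of it, and the jump costs at most about `ε ^ 2`.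
    have := C.integral_terminalProb_le (Function.update ξ i τ) (c := fun S => G.payoff S i)
      (fun S => hpay S i) (fun k => y k i + ε) (hend i τ) fun s t => ?_
    · rw [hinit fun k => y k i + ε] at this
      simp only [mul_add, Finset.sum_add_distrib, ← Finset.sum_mul, hp1, one_mul] at this
      exact this
    · rw [hstep (C.state s t) fun k => y k i + ε, hsum]
      set k := C.state s t
      have hqk : (ξ (a k)).quitAt s t = ε := by rw [hξ, if_pos rfl]
      have hq0 := τ.quitAt_nonneg s t
      have hq1 := τ.quitAt_le_one s t
      -- If the deviator is the designated quitter, no termination is guaranteed to absorb an error.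
      -- None arises: the averages under `P` and the jump target both give this player zero.
      by_cases hk : a k = i
      · rw [sum_stageProb_mul_of_singleton (a := i) fun j hj => hother i τ j s t hj (hk ▸ hj)]
        subst hk
        simp only [Function.update_self, if_true, Finset.singleton_ne_empty, if_false, hG, hPya,
          hyσ, hya]
        nlinarith
      · rw [sum_stageProb_mul_of_pair hk fun j hja hji => hother i τ j s t hji hja]
        simp only [Function.update_self, Function.update_of_ne hk, hqk, if_true,
          Finset.singleton_ne_empty, if_false, hG, Finset.insert_ne_empty]
        have h1 := hyP k i
        have h2 := hy1 (σ k) i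
        have h3 := hPy0 k i
        have h4 := hy0 k i
        have h5 := (abs_le.1 (hpay {a k, i} i)).2
        set X := ∑ l, P k l * y l i
        set q := τ.quitAt s t
        have hcont : (1 - ε) * ((1 - ε ^ 2) * (X + ε) + ε ^ 2 * (y (σ k) i + ε)) +
            ε * G.payoff {a k} i ≤ y k i + ε := by
          have h6 : (1 - ε ^ 2) * (X + ε) + ε ^ 2 * (y (σ k) i + ε) ≤ X + ε + ε ^ 2 := by
            nlinarith [mul_nonneg (sq_nonneg ε) h3, mul_le_mul_of_nonneg_left h2 (sq_nonneg ε)]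
          have h7 := mul_le_mul_of_nonneg_left h6 (sub_nonneg.2 hε1.le)
          have : 0 < ε ^ 3 := by positivity
          nlinarith
        -- Quitting alone pays zero, and quitting jointly pays at most one, with probability `ε`.
        have hquit : ε * G.payoff {a k, i} i ≤ y k i + ε := by nlinarith
        have h8 := mul_le_mul_of_nonneg_left hcont (sub_nonneg.2 hq1)
        have h9 := mul_le_mul_of_nonneg_left hquit hq0
        linarith
  have hlower : ∀ i, ∑ k, p k * y k i - ε ≤ G.expectedPayoff ξ i := by
    intro i
    -- The lower bound is the same comparison for the negated payoffs, with `y - ε` in place of `y +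
    -- ε`.
    have := C.integral_terminalProb_le ξ (c := fun S => -G.payoff S i)
      (fun S => by rw [abs_neg]; exact hpay S i) (fun k => -(y k i + -ε))
      (by simpa using hend i (ξ i)) fun s t => ?_
    · rw [hinit fun k => -(y k i + -ε)] at this
      simp only [mul_neg, Finset.sum_neg_distrib, integral_neg] at this
      have h := neg_le_neg_iff.1 this
      simp only [mul_add, mul_neg, Finset.sum_add_distrib, Finset.sum_neg_distrib, ← Finset.sum_mul,
        hp1, one_mul] at h
      exact h
    · rw [hstep (C.state s t) fun k => -(y k i + -ε)]
      simp only [mul_neg, Finset.sum_neg_distrib, hsum]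
      set k := C.state s t
      have hqk : (ξ (a k)).quitAt s t = ε := by rw [hξ, if_pos rfl]
      rw [sum_stageProb_mul_of_singleton (a := a k) fun j hj => by rw [hξ, if_neg (Ne.symm hj)]]
      simp only [hqk, if_true, Finset.singleton_ne_empty, if_false]
      have h1 := hyP k i
      have h2 := hy0 (σ k) i
      have h3 := hPy1 k i
      set X := ∑ l, P k l * y l i
      have h6 : X - ε - ε ^ 2 ≤ (1 - ε ^ 2) * (X + -ε) + ε ^ 2 * (y (σ k) i + -ε) := by
        nlinarith [mul_nonneg (sq_nonneg ε) h2, mul_le_mul_of_nonneg_left h3 (sq_nonneg ε)]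
      have h7 := mul_le_mul_of_nonneg_left h6 (sub_nonneg.2 hε1.le)
      have : 0 < ε ^ 3 := by positivity
      nlinarith
  refine ⟨ξ, fun i τ => ?_, fun i => abs_le.2 ?_⟩
  · linarith [hupper i τ, hlower i]
  · have := hupper i (ξ i)
    rw [Function.update_eq_self] at this
    constructor <;> linarith [hlower i]

end QuittingGame

/-! ### Inverse positivity of the matrix -/

namespace Matrix

variable {ι : Type*} [Fintype ι] {R : Matrix ι ι ℝ}

/-- A matrix with at most one positive entry in each row and every column meeting one of them is
monotone as soon as it maps some nonnegative vector to a positive one. -/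
lemma nonneg_of_mulVec_nonneg {π : ι → ι} (hπ : Function.Surjective π)
    (hneg : ∀ i j, j ≠ π i → R i j ≤ 0) {z : ι → ℝ} (hz : ∀ i, 0 ≤ z i)
    (hRz : ∀ i, 0 < (R *ᵥ z) i) {v : ι → ℝ} (hv : ∀ i, 0 ≤ (R *ᵥ v) i) (i : ι) : 0 ≤ v i := by
  have hrow : ∀ (u : ι → ℝ), (∀ j, 0 ≤ u j) → ∀ i, u (π i) = 0 → (R *ᵥ u) i ≤ 0 := by
    intro u hu i hi
    refine Finset.sum_nonpos fun j _ => ?_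
    by_cases hj : j = π i
    · rw [hj, hi, mul_zero]
    · exact mul_nonpos_of_nonpos_of_nonneg (hneg i j hj) (hu j)
  have hzpos : ∀ j, 0 < z j := fun j => by
    obtain ⟨i, rfl⟩ := hπ j
    exact (hz _).lt_of_ne fun h => (hRz i).not_ge (hrow z hz i h.symm)
  by_contra! hi
  -- At the least ratio `τ < 0`, attained at `π m`, the vector `v - τ • z` is nonnegative and
  -- vanishes at `π m`. Row `m` then gives `(R *ᵥ v) m ≤ τ * (R *ᵥ z) m < 0`.
  obtain ⟨j, -, hj⟩ := Finset.exists_min_image Finset.univ (fun j => v j / z j)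
    ⟨i, Finset.mem_univ i⟩
  have hτ : v j / z j < 0 :=
    (hj i (Finset.mem_univ i)).trans_lt (div_neg_of_neg_of_pos hi (hzpos i))
  obtain ⟨m, rfl⟩ := hπ j
  set τ := v (π m) / z (π m)
  have h1 := hrow (v - τ • z) (fun l => by
    have := (le_div_iff₀ (hzpos l)).1 (hj l (Finset.mem_univ l))
    simpa using this) m (by simp [τ, div_mul_cancel₀ _ (hzpos _).ne'])
  rw [mulVec_sub, mulVec_smul] at h1
  simp only [Pi.sub_apply, Pi.smul_apply, smul_eq_mul] at h1
  nlinarith [hv m, mul_neg_of_neg_of_pos hτ (hRz m)]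

/-- Two rows with their positive entries in the same column would contradict uniqueness in that
column. -/
lemma IsQuittingMMatrix.exists_injective (hR : R.IsQuittingMMatrix) :
    ∃ π : ι → ι, Function.Injective π ∧ (∀ i, 0 < R i (π i)) ∧ ∀ i j, j ≠ π i → R i j ≤ 0 := by
  choose π hπ hπu using fun i => hR.2.1 i
  refine ⟨π, fun i j hij => ?_, hπ, fun i j hj => ?_⟩
  · exact (hR.2.2 (π i)).unique (hπ i) (by simpa only [hij] using hπ j)
  · by_contra! h
    exact hj (hπu i j h)

variable [DecidableEq ι]

/-- There are at least three indices: an index differs from any given one and from the position of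
the positive entry in its row. -/
lemma IsQuittingMMatrix.exists_ne (hR : R.IsQuittingMMatrix) (hdiag : ∀ i, R i i = 0) {k m : ι}
    (hkm : 0 < R k m) : ∃ l, l ≠ k ∧ l ≠ m := by
  by_contra! h
  have hne : k ≠ m := fun h => by rw [h, hdiag] at hkm; exact hkm.false
  have hsum : ∀ f : ι → ℝ, ∑ l, f l = f k + f m := fun f => by
    rw [← Finset.sum_pair hne]
    refine (Finset.sum_subset (Finset.subset_univ _) fun l _ hl => ?_).symm
    simp only [Finset.mem_insert, Finset.mem_singleton, not_or] at hl
    exact (hl.2 (h l hl.1)).elim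
  obtain ⟨j, hj, -⟩ := hR.2.1 m
  have hjk : j = k := by
    by_contra hjk
    rw [h j hjk, hdiag] at hj
    exact hj.false
  subst hjk
  -- With only two indices, both off-diagonal entries are positive. For this `q`, `w m ≥ 1` forces
  -- `z m = 0`, and then `w j = -1`.
  obtain ⟨w, z, hw, hz, hwz, hc⟩ := hR.1 fun i => if i = j then -1 else 1
  have hwj := congrFun hwz j
  have hwm := congrFun hwz m
  simp only [Pi.add_apply, mulVec, dotProduct, hsum, hdiag, if_true, if_neg hne.symm, zero_mul,
    zero_add, add_zero] at hwj hwm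
  rcases hc m with h0 | h0
  · rw [h0, mul_zero] at hwj
    linarith [hw j]
  · nlinarith [hz j]

/-- The probability vectors with nonnegative image under the matrix form a simplex, whose vertices
are mapped to positive multiples of the unit vectors. -/
lemma IsQuittingMMatrix.exists_vertices (hR : R.IsQuittingMMatrix) :
    ∃ (α : ι → ι → ℝ) (c : ι → ℝ), (∀ k, 0 < c k) ∧ (∀ k i, 0 ≤ α k i) ∧
      (∀ k, ∑ i, α k i = 1) ∧ (∀ k, R *ᵥ α k = Pi.single k (c k)) ∧
      ∀ v : ι → ℝ, v = ∑ l, ((R *ᵥ v) l / c l) • α l := by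
  obtain ⟨π, hπ, -, hneg⟩ := hR.exists_injective
  -- For `q = -1` a solution satisfies `R z = w + 1 > 0`.
  obtain ⟨w, z, hw, hz, hwz, -⟩ := hR.1 fun _ => -1
  have hRz : ∀ i, 0 < (R *ᵥ z) i := fun i => by
    have := congrFun hwz i
    simp only [Pi.add_apply] at this
    linarith [hw i]
  have hmono : ∀ v : ι → ℝ, (∀ i, 0 ≤ (R *ᵥ v) i) → ∀ i, 0 ≤ v i := fun v hv =>
    nonneg_of_mulVec_nonneg (Finite.injective_iff_surjective.1 hπ) hneg hz hRz hv
  have hinj : Function.Injective R.mulVec := fun u v huv => by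
    have h0 : R *ᵥ (u - v) = 0 := by rw [mulVec_sub, sub_eq_zero]; exact huv
    refine funext fun i => le_antisymm ?_ ?_
    · have := hmono (-(u - v)) (fun j => by rw [mulVec_neg, h0]; simp) i
      simpa using this
    · simpa using hmono (u - v) (by simp [h0]) i
  have hunit : IsUnit R.det := (isUnit_iff_isUnit_det R).1 (mulVec_injective_iff_isUnit.1 hinj)
  obtain ⟨b, hb⟩ : ∃ b : ι → ι → ℝ, ∀ k, R *ᵥ b k = Pi.single k 1 :=
    ⟨fun k => R⁻¹ *ᵥ Pi.single k 1, fun k => by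
      rw [mulVec_mulVec, mul_nonsing_inv R hunit, one_mulVec]⟩
  have hb0 : ∀ k i, 0 ≤ b k i := fun k => hmono _ fun i => by
    rw [hb, Pi.single_apply]; split_ifs <;> simp
  have hbs : ∀ k, 0 < ∑ i, b k i := fun k => by
    refine (Finset.sum_nonneg fun i _ => hb0 k i).lt_of_ne fun h => ?_
    have h0 := (Finset.sum_eq_zero_iff_of_nonneg fun i _ => hb0 k i).1 h.symm
    have h1 := congrFun (hb k) k
    rw [show b k = 0 from funext fun i => h0 i (Finset.mem_univ i)] at h1
    simp at h1
  have hRα : ∀ k, R *ᵥ ((∑ i, b k i)⁻¹ • b k) =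
      Pi.single k (∑ i, b k i)⁻¹ := fun k => by
    rw [mulVec_smul, hb]
    ext i
    simp [Pi.single_apply]
  refine ⟨fun k => (∑ i, b k i)⁻¹ • b k,
    fun k => (∑ i, b k i)⁻¹, fun k => inv_pos.2 (hbs k),
    fun k i => mul_nonneg (inv_pos.2 (hbs k)).le (hb0 k i), fun k => ?_, hRα, fun v => hinj ?_⟩
  · simp only [Pi.smul_apply, smul_eq_mul, ← Finset.mul_sum]
    exact inv_mul_cancel₀ (hbs k).ne'
  · dsimp only
    rw [mulVec_sum]
    simp_rw [mulVec_smul R _ ((∑ i, b _ i)⁻¹ • b _), hRα]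
    ext i
    rw [Finset.sum_apply, Finset.sum_eq_single i]
    · simp [(hbs i).ne']
    · intro l _ hl; simp [hl.symm]
    · simp

end Matrix

/-! ### Payoffs from normal players quitting alone -/

namespace QuittingGame

variable {N : ℕ} (G : QuittingGame N)

/-- At the round that eliminates `i`, the normal player `j` is still present, so a nonpositive
payoff from `j` would have kept `i`. -/
lemma payoff_pos_of_notMem_normalPlayers {i j : Fin N} (hi : i ∉ G.normalPlayers)
    (hj : j ∈ G.normalPlayers) : 0 < G.payoff {j} i := by
  classical
  simp only [normalPlayers, Finset.mem_filter, Finset.mem_univ, true_and, not_forall] at hi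
  have hij : j ≠ i := by
    rintro rfl
    obtain ⟨l, hl⟩ := hi
    exact hl ((Finset.mem_filter.1 hj).2 l)
  have hjl : ∀ l, j ∈ G.normalStage l := (Finset.mem_filter.1 hj).2
  obtain ⟨l, hl⟩ := hi
  induction l with
  | zero => exact (hl (Finset.mem_univ i)).elim
  | succ l ih =>
    by_cases h : i ∈ G.normalStage l
    · by_contra! hle
      exact hl (Finset.mem_filter.2 ⟨h, j, hjl l, hij, hle⟩)
    · exact ih h

/-- The payoff vector obtained when a single normal player, drawn with weights `v`, quits. -/
noncomputable def mixedPayoff (v : G.normalPlayers → ℝ) (i : Fin N) : ℝ :=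
  ∑ j, v j * G.payoff {(j : Fin N)} i

lemma mixedPayoff_coe (v : G.normalPlayers → ℝ) (i : G.normalPlayers) :
    G.mixedPayoff v i = (G.normalMatrix.mulVec v) i := by
  simp only [mixedPayoff, normalMatrix, Matrix.mulVec, dotProduct, Matrix.of_apply, mul_comm]

lemma mixedPayoff_sum {κ : Type*} [Fintype κ] (p : κ → ℝ) (α : κ → G.normalPlayers → ℝ)
    (i : Fin N) : G.mixedPayoff (∑ l, p l • α l) i = ∑ l, p l * G.mixedPayoff (α l) i := by
  simp only [mixedPayoff, Finset.sum_apply, Pi.smul_apply, smul_eq_mul, Finset.sum_mul,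
    Finset.mul_sum, mul_assoc]
  exact Finset.sum_comm

/-- The signs of the weights are dropped: the coordinates with respect to the `α l` are read off
from `x` itself, and are nonnegative because `x` is. -/
lemma exists_mixedPayoff_eq {x : Fin N → ℝ}
    (hx : x ∈ convexHull ℝ
      ((fun i : Fin N => G.payoff {i}) '' (G.normalPlayers : Set (Fin N)))) :
    ∃ v : G.normalPlayers → ℝ, ∑ j, v j = 1 ∧ G.mixedPayoff v = x := by
  classical
  refine convexHull_min (t := {x | ∃ v : G.normalPlayers → ℝ, ∑ j, v j = 1 ∧
    G.mixedPayoff v = x}) ?_ ?_ hx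
  · rintro _ ⟨k, hk, rfl⟩
    refine ⟨Pi.single ⟨k, hk⟩ 1, by simp, funext fun i => ?_⟩
    rw [mixedPayoff, Finset.sum_eq_single ⟨k, hk⟩] <;> simp +contextual
  · rintro _ ⟨u, hu, rfl⟩ _ ⟨v, hv, rfl⟩ r s _ _ hrs
    refine ⟨r • u + s • v, ?_, funext fun i => ?_⟩
    · simp only [Pi.add_apply, Pi.smul_apply, smul_eq_mul, Finset.sum_add_distrib,
        ← Finset.mul_sum, hu, hv, mul_one, hrs]
    · simp only [mixedPayoff, Pi.add_apply, Pi.smul_apply, smul_eq_mul, add_mul,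
        Finset.sum_add_distrib, Finset.mul_sum, mul_assoc]

end QuittingGame

/-! ### The chain on the vertices of the simplex -/

theorem mainTheorem5 {N : ℕ} (G : QuittingGame N)
    (hG : ∀ i : Fin N, G.payoff {i} i = 0)
    (hM : G.normalMatrix.IsQuittingMMatrix)
    (x : Fin N → ℝ)
    (hx : x ∈ convexHull ℝ ((fun i : Fin N => G.payoff {i}) '' (G.normalPlayers : Set (Fin N))))
    (hx0 : ∀ i, 0 ≤ x i) :
    G.IsSunspotEquilibriumPayoff x := by
  obtain ⟨π, hπ, hpos, hneg⟩ := hM.exists_injective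
  obtain ⟨α, c, hc, hα0, hα1, hRα, hspan⟩ := hM.exists_vertices
  have hdiag : ∀ i, G.normalMatrix i i = 0 := fun i => hG i
  choose σ hσ hσπ using fun k => hM.exists_ne hdiag (hpos k)
  have hπne : ∀ k, π k ≠ k := fun k h => by
    have := hpos k
    rw [h, hdiag] at this
    exact this.false
  obtain ⟨v, hv1, rfl⟩ := G.exists_mixedPayoff_eq hx
  -- Each `α l` has total mass one, so summing the entries in `hspan` gives the total of the
  -- coefficients.
  have hweights : ∀ u : G.normalPlayers → ℝ, ∑ j, u j = 1 →
      ∑ l, (G.normalMatrix.mulVec u) l / c l = 1 := fun u hu => by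
    have h := congrArg (fun u => ∑ j, u j) (hspan u)
    simp only [Finset.sum_apply, Pi.smul_apply, smul_eq_mul, hu] at h
    rw [Finset.sum_comm] at h
    simpa only [← Finset.mul_sum, hα1, mul_one] using h.symm
  have hyR : ∀ k i : G.normalPlayers, G.mixedPayoff (α k) i = if i = k then c k else 0 :=
    fun k i => by rw [G.mixedPayoff_coe, hRα, Pi.single_apply]
  have hy0 : ∀ k i, 0 ≤ G.mixedPayoff (α k) i := fun k i => by
    by_cases hi : i ∈ G.normalPlayers
    · rw [hyR k ⟨i, hi⟩]
      split_ifs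
      exacts [(hc k).le, le_rfl]
    · exact Finset.sum_nonneg fun j _ =>
        mul_nonneg (hα0 k j) (G.payoff_pos_of_notMem_normalPlayers hi j.2).le
  have hy1 : ∀ k i, G.mixedPayoff (α k) i ≤ 1 := fun k i => by
    rw [← hα1 k]
    exact Finset.sum_le_sum fun j _ =>
      mul_le_of_le_one_right (hα0 k j) (G.payoff_mem {(j : Fin N)} i).2
  -- The bound `δ ≤ c k` keeps `c k - ε * R k (π k)` nonnegative for `ε ≤ δ`, as entries are at most
  -- one.
  have hsmall : ∃ δ : ℝ, 0 < δ ∧ δ < 1 ∧ ∀ k, δ ≤ c k := by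
    have h : ∀ᶠ δ in 𝓝[>] (0 : ℝ), 0 < δ ∧ δ < 1 ∧ ∀ k, δ ≤ c k :=
      (eventually_mem_nhdsWithin (a := (0 : ℝ)) (s := Set.Ioi 0)).and (nhdsWithin_le_nhds
        ((eventually_lt_nhds one_pos).and (eventually_all.2 fun k => eventually_le_nhds (hc k))))
    exact h.exists
  obtain ⟨δ, hδ0, hδ1, hδ⟩ := hsmall
  have hex : ∀ m : ℕ, ∃ ξ : Fin N → SunspotStrategy,
      G.IsSunspotEquilibrium (2 * (δ / (m + 1))) ξ ∧
      ∀ i, |G.expectedPayoff ξ i - G.mixedPayoff v i| ≤ δ / (m + 1) := by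
    intro m
    set ε : ℝ := δ / (m + 1) with hε
    have hε0 : 0 < ε := by positivity
    have hεδ : ε ≤ δ := div_le_self hδ0.le (by linarith [(Nat.cast_nonneg m : (0 : ℝ) ≤ m)])
    have hε1 : 0 < 1 - ε := by linarith
    -- These are the continuation weights, solving `α k = ε • e_{π k} + (1 - ε) • u k`. Their
    -- coordinates with respect to the `α l` become the transition probabilities out of `k`.
    let u : G.normalPlayers → G.normalPlayers → ℝ := fun k =>
      (1 - ε)⁻¹ • (α k - ε • Pi.single (π k) 1)
    have hu1 : ∀ k, ∑ j, u k j = 1 := fun k => by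
      simp only [u, Pi.smul_apply, Pi.sub_apply, smul_eq_mul, ← Finset.mul_sum,
        Finset.sum_sub_distrib, hα1, Finset.sum_pi_single', Finset.mem_univ, if_true, mul_one]
      exact inv_mul_cancel₀ hε1.ne'
    have hRu : ∀ k l, 0 ≤ (G.normalMatrix.mulVec (u k)) l := fun k l => by
      simp only [u, Matrix.mulVec_smul, Matrix.mulVec_sub, hRα, Matrix.mulVec_single_one,
        Pi.smul_apply, Pi.sub_apply, smul_eq_mul, Matrix.col_apply, Pi.single_apply]
      refine mul_nonneg (inv_pos.2 hε1).le ?_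
      have hle : G.normalMatrix l (π k) ≤ 1 := (G.payoff_mem _ _).2
      split_ifs with hlk
      · nlinarith [hδ k]
      -- Off row `k` the entry in column `π k` is nonpositive, so subtracting `ε` times it can only
      -- help.
      · have := hneg l (π k) fun h => hlk (hπ h).symm
        nlinarith
    obtain ⟨ξ, hξ, hξx⟩ := G.exists_sunspotEquilibrium hG (a := fun k => (π k : Fin N))
      (fun k l h => hπ (Subtype.ext h)) (y := fun k => G.mixedPayoff (α k)) hy0 hy1 hσ
      (fun k => by rw [hyR, if_neg (hπne k)]) (fun k => by rw [hyR, if_neg (hσπ k).symm])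
      hε0 (by linarith) (P := fun k l => (G.normalMatrix.mulVec (u k)) l / c l)
      (fun k l => div_nonneg (hRu k l) (hc l).le) (fun k => hweights _ (hu1 k)) (fun k i => by
        rw [← G.mixedPayoff_sum, ← hspan (u k)]
        have hsplit : G.mixedPayoff (u k) i =
            (1 - ε)⁻¹ * (G.mixedPayoff (α k) i - ε * G.payoff {(π k : Fin N)} i) := by
          have h1 : G.payoff {(π k : Fin N)} i = G.mixedPayoff (Pi.single (π k) 1) i := by
            simp [QuittingGame.mixedPayoff, Pi.single_apply]
          rw [h1]
          simp only [QuittingGame.mixedPayoff, u, Pi.smul_apply, Pi.sub_apply, smul_eq_mul,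
            Finset.mul_sum,
            ← Finset.sum_sub_distrib]
          exact Finset.sum_congr rfl fun j _ => by ring
        rw [hsplit, mul_inv_cancel_left₀ hε1.ne']
        ring)
      (p := fun l => (G.normalMatrix.mulVec v) l / c l)
      (fun l => div_nonneg (by rw [← G.mixedPayoff_coe]; exact hx0 l) (hc l).le) (hweights v hv1)
    refine ⟨ξ, hξ, fun i => ?_⟩
    have := hξx i
    rwa [← G.mixedPayoff_sum, ← hspan v] at this
  choose ξ hξ hξx using hex
  have hlim : Tendsto (fun m : ℕ => δ / ((m : ℝ) + 1)) atTop (𝓝 0) :=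
    tendsto_const_div_atTop_nhds_zero_nat δ |>.comp (tendsto_add_atTop_nat 1) |>.congr fun m => by
      simp
  refine ⟨fun m => 2 * (δ / (m + 1)), ξ, fun m => by positivity, by simpa using hlim.const_mul 2,
    hξ, tendsto_pi_nhds.2 fun i => ?_⟩
  rw [tendsto_iff_norm_sub_tendsto_zero]
  exact squeeze_zero (fun m => norm_nonneg _) (fun m => hξx m i) hlim
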